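/- Let $d\ge 1$ be an integer, $0<r\le\infty$, $1\le p<\infty$, $0<q<\infty$, and let $\psi:[1,\infty)\to(0,\infty)$ be nonincreasing; put $\psi(0):=\psi(1)$. For $k\in\mathbb Z^d$ let $|k|_r=(\sum_i|k_i|^r)^{1/r}$ if $r<\infty$ and $|k|_\infty=\max_i|k_i|$. For $f\in L_1(\mathbb T^d)$ (complex-valued, $2\pi$-periodic in each variable, integrable over $[0,2\pi]^d$) let $\widehat f(k)=(2\pi)^{-d}\int_{[0,2\pi]^d}f(x)e^{-i(k,x)}\,dx$ and $\|f\|_{S^p}=\big(\sum_{k\in\mathbb Z^d}|\widehat f(k)|^p\big)^{1/p}\in[0,\infty]$. Let $$\mathcal F^{\psi}_{q,r}=\Big\{f\in L_1(\mathbb T^d):\ \Big(\sum_{k\in\mathbb Z^d}\big(|\widehat f(k)|/\psi(|k|_r)\big)^q\Big)^{1/q}\le 1\Big\},$$ $$e_n(\mathcal F^{\psi}_{q,r})_{S^p}=\sup_{f\in\mathcal F^{\psi}_{q,r}}\ \inf_{\gamma_n,\,(c_k)}\Big\|f-\sum_{k\in\gamma_n}c_ke^{i(k,\cdot)}\Big\|_{S^p},$$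 where $\gamma_n$ runs over all sets of $n$ different vectors of $\mathbb Z^d$ and the $c_k$ over all complex numbers. Let $B$ be the set of all positive nonincreasing functions $\varphi$ on $[1,\infty)$ with $\varphi(t)\to0$ as $t\to\infty$ for which there are constants $c>1$ and $K$ with $1<\varphi(t)/\varphi(ct)\le K$ for all $t\ge1$. Let $\alpha(\psi,t)=\psi(t)/(t|\psi'(t+)|)$, where $\psi'(t+)$ is the right derivative. Assume that there are positive constants $M_0,c_1,c_2$ such that for all sufficiently large integers $m$ $$M_0(m-c_1)^d<\big|\{k\in\mathbb Z^d:|k|_r\le m\}\big|\le M_0(m+c_2)^d,$$ that $\psi^p\in B$ and, in the case $p<q$, that there are numbers $t_0$ and $K_\psi$ such that $\psi^p$ is convex on $(t_0,\infty)$ and $$\frac1{\alpha(\psi,t)}\ge K_\psi>d\Big(\frac1p-\frac1q\Big)\qquad\text{for all }t>t_0.$$ Then $$e_n(\mathcal F^{\psi}_{q,r})_{S^p}\asymp\psi(n^{1/d})\,n^{\frac1p-\frac1q},$$ that is, there are constants $0<K_1<K_2$, independent of $n$, such that for every $n\ge1$ the left side lies between $K_1$ times and $K_2$ times the right side. -/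

import Mathlib

open Real Set Filter Topology MeasureTheory
open scoped ENNReal

namespace NTerm

noncomputable section

/-- `L₁(𝕋^d)`: functions on `ℝ^d` that are `2π`-periodic in each variable and integrable over the
cube `[0, 2π]^d`. -/
def L1Torus (d : ℕ) : Set ((Fin d → ℝ) → ℂ) :=
  {f | (∀ i : Fin d, Function.Periodic f (Pi.single i (2 * π))) ∧
    IntegrableOn f (Icc (fun _ => 0) (fun _ => 2 * π)) volume}

/-- The exponential `e^{i(k,x)}`. -/
def expChar {d : ℕ} (k : Fin d → ℤ) (x : Fin d → ℝ) : ℂ :=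
  Complex.exp (Complex.I * ((∑ i, (k i : ℝ) * x i : ℝ) : ℂ))

/-- The Fourier coefficient `(2π)^{-d} ∫_{[0,2π]^d} f(x) e^{-i(k,x)} dx`. -/
def fourierCoef {d : ℕ} (f : (Fin d → ℝ) → ℂ) (k : Fin d → ℤ) : ℂ :=
  (((2 * π) ^ d : ℝ) : ℂ)⁻¹ *
    ∫ x in Icc (fun _ : Fin d => (0 : ℝ)) (fun _ => 2 * π),
      f x * Complex.exp (-(Complex.I * ((∑ i, (k i : ℝ) * x i : ℝ) : ℂ)))

/-- The `l_s` (quasi-)norm of a family, `0 < s < ∞`, with values in `[0, ∞]`. -/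
def lsNorm {ι E : Type*} [NormedAddCommGroup E] (s : ℝ) (a : ι → E) : ℝ≥0∞ :=
  (∑' k, ‖a k‖ₑ ^ s) ^ (1 / s)

/-- `|k|_r` for an integer vector `k` and `0 < r ≤ ∞`. -/
def latticeNorm {d : ℕ} (r : ℝ≥0∞) (k : Fin d → ℤ) : ℝ :=
  if r = ∞ then ⨆ i, |(k i : ℝ)| else (∑ i, |(k i : ℝ)| ^ r.toReal) ^ (1 / r.toReal)

/-- The number of `k ∈ ℤ^d` with `|k|_r ≤ m`. -/
def latticeCount (d : ℕ) (r : ℝ≥0∞) (m : ℕ) : ℕ :=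
  {k : Fin d → ℤ | latticeNorm r k ≤ m}.ncard

/-- The weight `ψ(|k|_r)`, with the convention `ψ(0) := ψ(1)`. -/
def weight {d : ℕ} (ψ : ℝ → ℝ) (r : ℝ≥0∞) (k : Fin d → ℤ) : ℝ :=
  if latticeNorm r k = 0 then ψ 1 else ψ (latticeNorm r k)

/-- The class `F^ψ_{q,r}` of functions on the `d`-dimensional torus, `0 < q < ∞`. -/
def classF (d : ℕ) (q : ℝ) (r : ℝ≥0∞) (ψ : ℝ → ℝ) : Set ((Fin d → ℝ) → ℂ) :=
  {f | f ∈ L1Torus d ∧ lsNorm q (fun k => ‖fourierCoef f k‖ / weight ψ r k) ≤ 1}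

/-- The (quasi-)norm of `S^p(𝕋^d)`, with values in `[0, ∞]`. -/
def normS {d : ℕ} (p : ℝ) (f : (Fin d → ℝ) → ℂ) : ℝ≥0∞ :=
  lsNorm p (fourierCoef f)

/-- The best `n`-term trigonometric approximation of `f` in `S^p(𝕋^d)`. -/
def bestNTerm {d : ℕ} (p : ℝ) (n : ℕ) (f : (Fin d → ℝ) → ℂ) : ℝ≥0∞ :=
  ⨅ (γ : Finset (Fin d → ℤ)) (_ : γ.card = n) (c : (Fin d → ℤ) → ℂ),
    normS p (fun x => f x - ∑ k ∈ γ, c k * expChar k x)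

/-- The best `n`-term trigonometric approximation of a class of functions in `S^p(𝕋^d)`. -/
def bestNTermClass {d : ℕ} (p : ℝ) (n : ℕ) (N : Set ((Fin d → ℝ) → ℂ)) : ℝ≥0∞ :=
  ⨆ f ∈ N, bestNTerm p n f

/-- The set `B` of functions on `[1, ∞)`. -/
structure MemB (φ : ℝ → ℝ) : Prop where
  pos : ∀ t, 1 ≤ t → 0 < φ t
  anti : AntitoneOn φ (Ici 1)
  tendsto_zero : Tendsto φ atTop (𝓝 0)
  doubling : ∃ c K : ℝ, 1 < c ∧ ∀ t, 1 ≤ t → 1 < φ t / φ (c * t) ∧ φ t / φ (c * t) ≤ K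

/-- `α(ψ, t) = ψ(t) / (t |ψ'(t+)|)`. -/
def alpha (ψ : ℝ → ℝ) (t : ℝ) : ℝ :=
  ψ t / (t * |derivWithin ψ (Ioi t) t|)

/-- `a(n) ≍ b(n)`: two-sided estimate, for all `n ≥ 1`, with positive finite constants. -/
def SameOrder (a : ℕ → ℝ≥0∞) (b : ℕ → ℝ) : Prop :=
  ∃ K₁ K₂ : ℝ, 0 < K₁ ∧ K₁ < K₂ ∧ ∀ n : ℕ, 1 ≤ n →
    ENNReal.ofReal (K₁ * b n) ≤ a n ∧ a n ≤ ENNReal.ofReal (K₂ * b n)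

end

end NTerm

/-!
Passing to Fourier coefficients turns the quantity to be estimated into the largest error of
`n`-term approximation in `l_p` over `ℤ^d` of families `a` whose weighted `l_q` quasi-norm is at
most `1`.

Upper bound: keep the at most `n / 2` frequencies of a cube of side comparable with `n ^ (1 / d)`.
Outside of it the weight is at most a constant times `ψ (n ^ (1 / d))`, since `ψ` is antitone and
doubling. If `q ≤ p`, keeping the other `n / 2` largest entries of `a k / weight k` gains the factor
`n ^ (1 / p - 1 / q)`. If `p < q`, Hölder's inequality with `1 / s = 1 / p - 1 / q` bounds the error
by the `l_s` norm of the weight outside of the cube; the condition on `α` makes `ψ` decay at least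
as fast as `t ^ (-K)` with `K * s > d`, so that the sum over dyadic shells is geometric.

Lower bound: a polynomial with `2 * n` equal coefficients on frequencies of size `≲ n ^ (1 / d)`
loses at least `n` of them in any `n`-term approximation.
-/

namespace NTerm

section SequenceSpaces

variable {ι E F G : Type*} [NormedAddCommGroup E] [NormedAddCommGroup F] [NormedAddCommGroup G]
  {p q s : ℝ}

theorem lsNorm_le_one_iff (hs : 0 < s) {a : ι → E} : lsNorm s a ≤ 1 ↔ ∑' k, ‖a k‖ₑ ^ s ≤ 1 := by
  rw [lsNorm, one_div, ENNReal.rpow_inv_le_iff hs, ENNReal.one_rpow]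

theorem lsNorm_le_mul_lsNorm (hs : 0 < s) {a : ι → E} {b : ι → F} {M : ℝ≥0∞}
    (h : ∀ k, ‖a k‖ₑ ≤ M * ‖b k‖ₑ) : lsNorm s a ≤ M * lsNorm s b := by
  calc lsNorm s a ≤ (∑' k, M ^ s * ‖b k‖ₑ ^ s) ^ (1 / s) := by
        unfold lsNorm
        gcongr with k
        exact (ENNReal.rpow_le_rpow (h k) hs.le).trans_eq (ENNReal.mul_rpow_of_nonneg _ _ hs.le)
    _ = M * lsNorm s b := by
        rw [ENNReal.tsum_mul_left, ENNReal.mul_rpow_of_nonneg _ _ (by positivity), one_div,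
          ENNReal.rpow_rpow_inv hs.ne', lsNorm, one_div]

theorem lsNorm_mono (hs : 0 < s) {a : ι → E} {b : ι → F} (h : ∀ k, ‖a k‖ₑ ≤ ‖b k‖ₑ) :
    lsNorm s a ≤ lsNorm s b := by
  simpa only [one_mul] using lsNorm_le_mul_lsNorm hs (M := 1) (by simpa only [one_mul] using h)

theorem lsNorm_le_lsNorm_mul_lsNorm (hp : 0 < p) (hpq : p < q) (hpqs : 1 / p = 1 / q + 1 / s)
    {a : ι → E} {b : ι → F} {w : ι → G} (h : ∀ k, ‖a k‖ₑ ≤ ‖b k‖ₑ * ‖w k‖ₑ) :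
    lsNorm p a ≤ lsNorm q b * lsNorm s w := by
  let : MeasurableSpace ι := ⊤
  have holder := ENNReal.lintegral_Lp_mul_le_Lq_mul_Lr hp hpq hpqs Measure.count
    (f := fun k => ‖b k‖ₑ) (g := fun k => ‖w k‖ₑ) measurable_from_top.aemeasurable
    measurable_from_top.aemeasurable
  simp only [lintegral_count, Pi.mul_apply] at holder
  refine le_trans ?_ holder
  unfold lsNorm
  gcongr with k
  exact h k

theorem lsNorm_le_of_enorm_le (hq : 0 < q) (hqp : q ≤ p) {a : ι → E} {δ : ℝ≥0∞}
    (h : ∀ k, ‖a k‖ₑ ≤ δ) : lsNorm p a ≤ δ ^ (1 - q / p) * lsNorm q a ^ (q / p) := by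
  have hp : 0 < p := hq.trans_le hqp
  have hterm (k : ι) : ‖a k‖ₑ ^ p ≤ δ ^ (p - q) * ‖a k‖ₑ ^ q := by
    calc ‖a k‖ₑ ^ p = ‖a k‖ₑ ^ (p - q) * ‖a k‖ₑ ^ q := by
          rw [← ENNReal.rpow_add_of_nonneg _ _ (sub_nonneg.mpr hqp) hq.le, sub_add_cancel]
      _ ≤ δ ^ (p - q) * ‖a k‖ₑ ^ q := by
          gcongr
          exact h k
  calc lsNorm p a ≤ (δ ^ (p - q) * ∑' k, ‖a k‖ₑ ^ q) ^ (1 / p) := by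
        rw [lsNorm, ← ENNReal.tsum_mul_left]
        gcongr with k
        exact hterm k
    _ = δ ^ (1 - q / p) * lsNorm q a ^ (q / p) := by
        rw [ENNReal.mul_rpow_of_nonneg _ _ (by positivity), lsNorm, ← ENNReal.rpow_mul,
          ← ENNReal.rpow_mul]
        congr 2 <;> field_simp

theorem lsNorm_indicator_le (hs : 0 < s) (Γ : Finset ι) {a : ι → E} {δ : ℝ≥0∞}
    (h : ∀ k ∈ Γ, ‖a k‖ₑ ≤ δ) :
    lsNorm s ((Γ : Set ι).indicator a) ≤ (Γ.card : ℝ≥0∞) ^ (1 / s) * δ := by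
  have hsum : ∑' k, ‖(Γ : Set ι).indicator a k‖ₑ ^ s ≤ Γ.card * δ ^ s := by
    rw [tsum_eq_sum (s := Γ) fun k hk => by simp [hk, hs], ← nsmul_eq_mul]
    refine Finset.sum_le_card_nsmul _ _ _ fun k hk => ?_
    rw [Set.indicator_of_mem (Finset.mem_coe.mpr hk)]
    exact ENNReal.rpow_le_rpow (h k hk) hs.le
  calc lsNorm s ((Γ : Set ι).indicator a) ≤ (Γ.card * δ ^ s) ^ (1 / s) :=
        ENNReal.rpow_le_rpow hsum (by positivity)
    _ = (Γ.card : ℝ≥0∞) ^ (1 / s) * δ := by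
        rw [ENNReal.mul_rpow_of_nonneg _ _ (by positivity), one_div, ENNReal.rpow_rpow_inv hs.ne']

theorem card_rpow_mul_le_lsNorm (hs : 0 < s) (Γ : Finset ι) {a : ι → E} {δ : ℝ≥0∞}
    (h : ∀ k ∈ Γ, δ ≤ ‖a k‖ₑ) : (Γ.card : ℝ≥0∞) ^ (1 / s) * δ ≤ lsNorm s a := by
  have hsum : Γ.card * δ ^ s ≤ ∑' k, ‖a k‖ₑ ^ s := by
    rw [← nsmul_eq_mul]
    exact (Finset.card_nsmul_le_sum _ _ _ fun k hk => ENNReal.rpow_le_rpow (h k hk) hs.le).trans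
      (ENNReal.sum_le_tsum Γ)
  calc (Γ.card : ℝ≥0∞) ^ (1 / s) * δ = (Γ.card * δ ^ s) ^ (1 / s) := by
        rw [ENNReal.mul_rpow_of_nonneg _ _ (by positivity), one_div, ENNReal.rpow_rpow_inv hs.ne']
    _ ≤ lsNorm s a := ENNReal.rpow_le_rpow hsum (by positivity)

/-- The error `σ_n(a)` of the best approximation of the family `a` in the `l_p` (quasi-)norm by
families supported on `n` indices: the best approximation keeps the entries of `a` on its support,
so only the set of the indices to keep has to be chosen. -/
noncomputable def nTermError (p : ℝ) (n : ℕ) (a : ι → E) : ℝ≥0∞ :=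
  ⨅ (γ : Finset ι) (_ : γ.card = n), lsNorm p ((γ : Set ι)ᶜ.indicator a)

theorem nTermError_le_lsNorm_indicator_compl [Infinite ι] (hp : 0 < p) {n : ℕ} (a : ι → E)
    {Γ : Finset ι} (hΓ : Γ.card ≤ n) : nTermError p n a ≤ lsNorm p ((Γ : Set ι)ᶜ.indicator a) := by
  obtain ⟨γ, hΓγ, hγ⟩ := Infinite.exists_superset_card_eq Γ n hΓ
  exact (iInf₂_le γ hγ).trans <| lsNorm_mono hp <| enorm_indicator_le_of_subset
    (compl_subset_compl.mpr (Finset.coe_subset.mpr hΓγ)) a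

theorem nTermError_le_mul_nTermError (hp : 0 < p) (n : ℕ) {a : ι → E} {b : ι → F} {M : ℝ≥0∞}
    (hM0 : M ≠ 0) (hM : M ≠ ∞) (h : ∀ k, ‖a k‖ₑ ≤ M * ‖b k‖ₑ) :
    nTermError p n a ≤ M * nTermError p n b := by
  simp only [nTermError, ENNReal.mul_iInf_of_ne hM0 hM]
  gcongr with γ
  refine lsNorm_le_mul_lsNorm hp fun k => ?_
  by_cases hk : k ∈ γ
  · simp [hk]
  · simpa [hk] using h k

theorem nTermError_card_add_le [Infinite ι] (hp : 0 < p) (Γ : Finset ι) (m : ℕ) (a : ι → E) :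
    nTermError p (Γ.card + m) a ≤ nTermError p m ((Γ : Set ι)ᶜ.indicator a) := by
  classical
  refine le_iInf₂ fun γ hγ => ?_
  rw [Set.indicator_indicator, Set.inter_comm, ← Set.compl_union, ← Finset.coe_union]
  exact nTermError_le_lsNorm_indicator_compl hp a (hγ ▸ Finset.card_union_le Γ γ)

theorem nTermError_le_rpow_of_lsNorm_le_one [Infinite ι] (hq : 0 < q) (hqp : q ≤ p) {n : ℕ}
    {a : ι → E} (ha : lsNorm q a ≤ 1) : nTermError p n a ≤ (n : ℝ≥0∞) ^ (1 / p - 1 / q) := by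
  have hp : 0 < p := hq.trans_le hqp
  have hn0 : (n : ℝ≥0∞)⁻¹ ≠ 0 := ENNReal.inv_ne_zero.mpr (ENNReal.natCast_ne_top n)
  -- By Chebyshev's inequality at most `n` entries satisfy `‖a k‖ ^ q ≥ 1 / n`; keep those.
  obtain ⟨hfin, hcard⟩ := ENNReal.finset_card_const_le_le_of_tsum_le ENNReal.one_ne_top
    ((lsNorm_le_one_iff hq).mp ha) hn0
  set Λ := hfin.toFinset
  have hΛ : Λ.card ≤ n := by
    rw [one_div, inv_inv] at hcard
    exact_mod_cast hcard
  set b := (Λ : Set ι)ᶜ.indicator a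
  have hsmall (k : ι) : ‖b k‖ₑ ≤ (n : ℝ≥0∞)⁻¹ ^ (1 / q) := by
    by_cases hk : k ∈ Λ
    · simp [b, hk]
    · have hlt : ‖a k‖ₑ ^ q < (n : ℝ≥0∞)⁻¹ := by simpa [Λ] using hk
      have hbk : b k = a k := Set.indicator_of_mem (by simpa using hk) a
      rw [hbk, one_div, ENNReal.le_rpow_inv_iff hq]
      exact hlt.le
  have hb : lsNorm q b ≤ 1 := (lsNorm_mono hq (enorm_indicator_le_enorm_self a)).trans ha
  calc nTermError p n a ≤ lsNorm p b := nTermError_le_lsNorm_indicator_compl hp a hΛ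
    _ ≤ ((n : ℝ≥0∞)⁻¹ ^ (1 / q)) ^ (1 - q / p) * lsNorm q b ^ (q / p) :=
        lsNorm_le_of_enorm_le hq hqp hsmall
    _ ≤ ((n : ℝ≥0∞)⁻¹ ^ (1 / q)) ^ (1 - q / p) :=
        mul_le_of_le_one_right' (ENNReal.rpow_le_one hb (by positivity))
    _ = (n : ℝ≥0∞) ^ (1 / p - 1 / q) := by
        rw [← ENNReal.rpow_mul, ENNReal.inv_rpow, ← ENNReal.rpow_neg]
        congr 1
        field_simp
        ring

theorem rpow_mul_le_nTermError (hp : 0 < p) {n : ℕ} {Γ : Finset ι} (hΓ : 2 * n ≤ Γ.card)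
    {a : ι → E} {δ : ℝ≥0∞} (h : ∀ k ∈ Γ, δ ≤ ‖a k‖ₑ) :
    (n : ℝ≥0∞) ^ (1 / p) * δ ≤ nTermError p n a := by
  classical
  refine le_iInf₂ fun γ hγ => ?_
  have hcard : n ≤ (Γ \ γ).card := by
    have := Finset.le_card_sdiff γ Γ
    omega
  calc (n : ℝ≥0∞) ^ (1 / p) * δ ≤ ((Γ \ γ).card : ℝ≥0∞) ^ (1 / p) * δ := by gcongr
    _ ≤ lsNorm p ((γ : Set ι)ᶜ.indicator a) := by
        refine card_rpow_mul_le_lsNorm hp _ fun k hk => ?_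
        obtain ⟨hkΓ, hkγ⟩ := Finset.mem_sdiff.mp hk
        simpa [hkγ] using h k hkΓ

theorem enorm_eq_enorm_div_mul_enorm {w : ℝ} (hw : w ≠ 0) (z : E) :
    ‖z‖ₑ = ‖‖z‖ / w‖ₑ * ‖w‖ₑ := by
  rw [← enorm_mul, div_mul_cancel₀ _ hw, enorm_norm]

theorem nTermError_le_of_weight_le [Infinite ι] (hq : 0 < q) (hqp : q ≤ p) {a : ι → E} {w : ι → ℝ}
    (hw : ∀ k, 0 < w k) (ha : lsNorm q (fun k => ‖a k‖ / w k) ≤ 1) {Γ : Finset ι} {M : ℝ}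
    (hM : ∀ k ∉ Γ, w k ≤ M) {n : ℕ} (hn : 1 ≤ n) (hΓ : 2 * Γ.card ≤ n) :
    nTermError p n a ≤ ENNReal.ofReal (M * (n / 2 : ℝ) ^ (1 / p - 1 / q)) := by
  have hp : 0 < p := hq.trans_le hqp
  obtain ⟨m, rfl⟩ := Nat.exists_eq_add_of_le (show Γ.card ≤ n by omega)
  have hexp : 1 / p - 1 / q ≤ 0 := sub_nonpos.mpr (one_div_le_one_div_of_le hq hqp)
  have hM0 : 0 < M := by
    obtain ⟨k, hk⟩ := Infinite.exists_notMem_finset Γ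
    exact (hw k).trans_le (hM k hk)
  have hdom (k : ι) : ‖(Γ : Set ι)ᶜ.indicator a k‖ₑ ≤ ENNReal.ofReal M * ‖‖a k‖ / w k‖ₑ := by
    by_cases hk : k ∈ Γ
    · simp [hk]
    · rw [Set.indicator_of_mem (by simpa using hk), enorm_eq_enorm_div_mul_enorm (hw k).ne' (a k),
        mul_comm, Real.enorm_of_nonneg (hw k).le]
      gcongr
      exact hM k hk
  calc nTermError p (Γ.card + m) a ≤ nTermError p m ((Γ : Set ι)ᶜ.indicator a) :=
        nTermError_card_add_le hp Γ m a
    _ ≤ ENNReal.ofReal M * nTermError p m (fun k => ‖a k‖ / w k) :=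
        nTermError_le_mul_nTermError hp m (ENNReal.ofReal_pos.mpr hM0).ne' ENNReal.ofReal_ne_top
          hdom
    _ ≤ ENNReal.ofReal M * (m : ℝ≥0∞) ^ (1 / p - 1 / q) := by
        gcongr
        exact nTermError_le_rpow_of_lsNorm_le_one hq hqp ha
    _ = ENNReal.ofReal (M * (m : ℝ) ^ (1 / p - 1 / q)) := by
        rw [ENNReal.ofReal_mul hM0.le, ← ENNReal.ofReal_rpow_of_pos (by norm_cast; omega),
          ENNReal.ofReal_natCast]
    _ ≤ ENNReal.ofReal (M * ((Γ.card + m : ℕ) / 2 : ℝ) ^ (1 / p - 1 / q)) := by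
        gcongr ENNReal.ofReal (M * ?_)
        refine Real.rpow_le_rpow_of_nonpos (by positivity) ?_ hexp
        rw [div_le_iff₀ two_pos]
        norm_cast
        omega

theorem nTermError_le_lsNorm_weight [Infinite ι] (hp : 0 < p) (hpq : p < q)
    (hpqs : 1 / p = 1 / q + 1 / s) {a : ι → E} {w : ι → ℝ} (hw : ∀ k, 0 < w k)
    (ha : lsNorm q (fun k => ‖a k‖ / w k) ≤ 1) {Γ : Finset ι} {n : ℕ} (hΓ : Γ.card ≤ n) :
    nTermError p n a ≤ lsNorm s ((Γ : Set ι)ᶜ.indicator w) := by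
  have hfactor (k : ι) : ‖(Γ : Set ι)ᶜ.indicator a k‖ₑ
      ≤ ‖‖a k‖ / w k‖ₑ * ‖(Γ : Set ι)ᶜ.indicator w k‖ₑ := by
    by_cases hk : k ∈ Γ
    · simp [hk]
    · simpa [hk] using (enorm_eq_enorm_div_mul_enorm (hw k).ne' (a k)).le
  calc nTermError p n a ≤ lsNorm p ((Γ : Set ι)ᶜ.indicator a) :=
        nTermError_le_lsNorm_indicator_compl hp a hΓ
    _ ≤ lsNorm q (fun k => ‖a k‖ / w k) * lsNorm s ((Γ : Set ι)ᶜ.indicator w) :=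
        lsNorm_le_lsNorm_mul_lsNorm hp hpq hpqs hfactor
    _ ≤ lsNorm s ((Γ : Set ι)ᶜ.indicator w) := mul_le_of_le_one_left' ha

end SequenceSpaces

section FourierCoefficients

variable {d : ℕ} {f g : (Fin d → ℝ) → ℂ}

theorem continuous_expChar (k : Fin d → ℤ) : Continuous (expChar k) := by
  unfold expChar
  fun_prop

theorem norm_expChar (k : Fin d → ℤ) (x : Fin d → ℝ) : ‖expChar k x‖ = 1 :=
  Complex.norm_exp_I_mul_ofReal _

theorem expChar_add (j k : Fin d → ℤ) (x : Fin d → ℝ) :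
    expChar (j + k) x = expChar j x * expChar k x := by
  simp only [expChar, ← Complex.exp_add, ← mul_add, ← Complex.ofReal_add,
    ← Finset.sum_add_distrib, Pi.add_apply, Int.cast_add, add_mul]

theorem expChar_eq_prod (k : Fin d → ℤ) (x : Fin d → ℝ) :
    expChar k x = ∏ i, Complex.exp (Complex.I * (k i * x i : ℝ)) := by
  rw [expChar, ← Complex.exp_sum, Complex.ofReal_sum, Finset.mul_sum]

theorem periodic_expChar (k : Fin d → ℤ) (i : Fin d) :
    Function.Periodic (expChar k) (Pi.single i (2 * π)) := by
  intro x
  have hsum : ∑ j, (k j : ℝ) * (x + Pi.single i (2 * π) : Fin d → ℝ) j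
      = ∑ j, (k j : ℝ) * x j + k i * (2 * π) := by
    simp [mul_add, Finset.sum_add_distrib, Pi.single_apply]
  refine Complex.exp_eq_exp_iff_exists_int.mpr ⟨k i, ?_⟩
  rw [hsum]
  push_cast
  ring

theorem fourierCoef_eq_integral_mul_expChar (f : (Fin d → ℝ) → ℂ) (k : Fin d → ℤ) :
    fourierCoef f k = (((2 * π) ^ d : ℝ) : ℂ)⁻¹ *
      ∫ x in Icc (fun _ : Fin d => (0 : ℝ)) (fun _ => 2 * π), f x * expChar (-k) x := by
  simp [fourierCoef, expChar]

theorem integrableOn_mul_expChar {S : Set (Fin d → ℝ)} (hf : IntegrableOn f S) (k : Fin d → ℤ) :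
    IntegrableOn (fun x => f x * expChar k x) S :=
  hf.mul_bdd (continuous_expChar k).aestronglyMeasurable
    (ae_of_all _ fun x => (norm_expChar k x).le)

theorem fourierCoef_sub (hf : IntegrableOn f (Icc (fun _ => 0) (fun _ => 2 * π)))
    (hg : IntegrableOn g (Icc (fun _ => 0) (fun _ => 2 * π))) (k : Fin d → ℤ) :
    fourierCoef (fun x => f x - g x) k = fourierCoef f k - fourierCoef g k := by
  simp only [fourierCoef_eq_integral_mul_expChar, sub_mul]
  rw [integral_sub (integrableOn_mul_expChar hf (-k)) (integrableOn_mul_expChar hg (-k)), mul_sub]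

theorem fourierCoef_finsetSum {ι : Type*} (s : Finset ι) {F : ι → (Fin d → ℝ) → ℂ}
    (hF : ∀ i ∈ s, IntegrableOn (F i) (Icc (fun _ => 0) (fun _ => 2 * π))) (k : Fin d → ℤ) :
    fourierCoef (fun x => ∑ i ∈ s, F i x) k = ∑ i ∈ s, fourierCoef (F i) k := by
  simp only [fourierCoef_eq_integral_mul_expChar, Finset.sum_mul]
  rw [integral_finsetSum s fun i hi => integrableOn_mul_expChar (hF i hi) (-k), Finset.mul_sum]

theorem fourierCoef_const_mul (c : ℂ) (f : (Fin d → ℝ) → ℂ) (k : Fin d → ℤ) :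
    fourierCoef (fun x => c * f x) k = c * fourierCoef f k := by
  simp only [fourierCoef, mul_assoc, integral_const_mul]
  ring

theorem integral_exp_I_mul_intCast_mul (m : ℤ) :
    ∫ x in Icc (0 : ℝ) (2 * π), Complex.exp (Complex.I * (m * x : ℝ))
      = if m = 0 then ((2 * π : ℝ) : ℂ) else 0 := by
  rw [integral_Icc_eq_integral_Ioc, ← intervalIntegral.integral_of_le (by positivity)]
  split_ifs with hm
  · simp [hm]
  · have hc : Complex.I * (m : ℂ) ≠ 0 := by simp [hm]
    have hperiod : Complex.exp (Complex.I * m * ((2 * π : ℝ) : ℂ)) = 1 :=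
      Complex.exp_eq_one_iff.mpr ⟨m, by push_cast; ring⟩
    simp only [Complex.ofReal_mul, Complex.ofReal_intCast, ← mul_assoc]
    rw [integral_exp_mul_complex hc, hperiod]
    simp

theorem integral_expChar (k : Fin d → ℤ) :
    ∫ x in Icc (fun _ : Fin d => (0 : ℝ)) (fun _ => 2 * π), expChar k x
      = if k = 0 then (((2 * π) ^ d : ℝ) : ℂ) else 0 := by
  simp only [expChar_eq_prod]
  rw [← Set.pi_univ_Icc, volume_pi, Measure.restrict_pi_pi,
    integral_fintype_prod_eq_prod (𝕜 := ℂ)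
      (f := fun i (t : ℝ) => Complex.exp (Complex.I * (k i * t : ℝ)))]
  simp only [integral_exp_I_mul_intCast_mul]
  split_ifs with hk
  · simp [hk]
  · obtain ⟨i, hi⟩ := Function.ne_iff.mp hk
    exact Finset.prod_eq_zero (Finset.mem_univ i) (if_neg hi)

theorem fourierCoef_expChar (j k : Fin d → ℤ) :
    fourierCoef (expChar j) k = if j = k then 1 else 0 := by
  simp only [fourierCoef_eq_integral_mul_expChar, ← expChar_add, integral_expChar,
    ← sub_eq_add_neg, sub_eq_zero]
  split_ifs
  · exact inv_mul_cancel₀ (by exact_mod_cast (by positivity : ((2 * π) ^ d : ℝ) ≠ 0))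
  · exact mul_zero _

theorem sum_mul_expChar_mem_L1Torus (Γ : Finset (Fin d → ℤ)) (c : (Fin d → ℤ) → ℂ) :
    (fun x => ∑ k ∈ Γ, c k * expChar k x) ∈ L1Torus d := by
  constructor
  · exact fun i x => Finset.sum_congr rfl fun k _ => by rw [periodic_expChar k i x]
  · have hcont : Continuous fun x => ∑ k ∈ Γ, c k * expChar k x :=
      continuous_finsetSum _ fun k _ => continuous_const.mul (continuous_expChar k)
    exact hcont.continuousOn.integrableOn_compact isCompact_Icc

theorem fourierCoef_sum_mul_expChar (Γ : Finset (Fin d → ℤ)) (c : (Fin d → ℤ) → ℂ) :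
    fourierCoef (fun x => ∑ k ∈ Γ, c k * expChar k x) = (Γ : Set (Fin d → ℤ)).indicator c := by
  ext k
  have hint (j : Fin d → ℤ) :
      IntegrableOn (fun x => c j * expChar j x) (Icc (fun _ => 0) (fun _ => 2 * π)) :=
    (continuous_const.mul (continuous_expChar j)).continuousOn.integrableOn_compact isCompact_Icc
  rw [fourierCoef_finsetSum Γ fun j _ => hint j]
  simp [fourierCoef_const_mul, fourierCoef_expChar, Set.indicator_apply]

theorem fourierCoef_sub_sum_mul_expChar (hf : f ∈ L1Torus d) (γ : Finset (Fin d → ℤ))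
    (c : (Fin d → ℤ) → ℂ) :
    fourierCoef (fun x => f x - ∑ k ∈ γ, c k * expChar k x)
      = fourierCoef f - (γ : Set (Fin d → ℤ)).indicator c := by
  ext k
  rw [fourierCoef_sub hf.2 (sum_mul_expChar_mem_L1Torus γ c).2, fourierCoef_sum_mul_expChar,
    Pi.sub_apply]

theorem bestNTerm_eq_nTermError {p : ℝ} (hp : 0 < p) (n : ℕ) (hf : f ∈ L1Torus d) :
    bestNTerm p n f = nTermError p n (fourierCoef f) := by
  refine iInf_congr fun γ => iInf_congr fun _ => ?_
  simp only [normS, fourierCoef_sub_sum_mul_expChar hf]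
  refine le_antisymm ?_ (le_iInf fun c => lsNorm_mono hp fun k => ?_)
  · exact iInf_le_of_le (fourierCoef f) (by rw [Set.indicator_compl])
  · by_cases hk : k ∈ γ <;> simp [hk]

theorem bestNTermClass_le {p q : ℝ} (hp : 0 < p) {r : ℝ≥0∞} {ψ : ℝ → ℝ} {n : ℕ} {A : ℝ≥0∞}
    (h : ∀ a : (Fin d → ℤ) → ℂ, lsNorm q (fun k => ‖a k‖ / weight ψ r k) ≤ 1 →
      nTermError p n a ≤ A) : bestNTermClass p n (classF d q r ψ) ≤ A :=
  iSup₂_le fun f hf => (bestNTerm_eq_nTermError hp n hf.1).trans_le (h (fourierCoef f) hf.2)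

theorem nTermError_indicator_le_bestNTermClass {p q : ℝ} (hp : 0 < p) {r : ℝ≥0∞} {ψ : ℝ → ℝ}
    (n : ℕ) {Γ : Finset (Fin d → ℤ)} {c : (Fin d → ℤ) → ℂ}
    (h : lsNorm q (fun k => ‖(Γ : Set (Fin d → ℤ)).indicator c k‖ / weight ψ r k) ≤ 1) :
    nTermError p n ((Γ : Set (Fin d → ℤ)).indicator c)
      ≤ bestNTermClass p n (classF d q r ψ) := by
  have hL := sum_mul_expChar_mem_L1Torus Γ c
  rw [← fourierCoef_sum_mul_expChar] at h ⊢
  rw [← bestNTerm_eq_nTermError hp n hL]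
  exact le_iSup₂_of_le _ ⟨hL, h⟩ le_rfl

end FourierCoefficients

section LatticeCubes

variable {d m : ℕ} {r : ℝ≥0∞} {ψ : ℝ → ℝ} {k : Fin d → ℤ} {t : ℝ}

/-- The integer vectors of maximum norm less than `m`. -/
noncomputable def latticeCube (d m : ℕ) : Finset (Fin d → ℤ) :=
  Fintype.piFinset fun _ => Finset.Ioo (-(m : ℤ)) m

theorem card_latticeCube (d m : ℕ) : (latticeCube d m).card = (2 * m - 1) ^ d := by
  simp only [latticeCube, Fintype.card_piFinset_const, Int.card_Ioo]
  congr 1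
  omega

theorem norm_le_of_mem_latticeCube (hk : k ∈ latticeCube d m) : ‖k‖ ≤ m := by
  refine (pi_norm_le_iff_of_nonneg m.cast_nonneg).mpr fun i => ?_
  have hi := abs_lt.mpr (Finset.mem_Ioo.mp (Fintype.mem_piFinset.mp hk i))
  rw [Int.norm_eq_abs]
  exact_mod_cast hi.le

theorem le_norm_of_notMem_latticeCube (hk : k ∉ latticeCube d m) : (m : ℝ) ≤ ‖k‖ := by
  obtain ⟨i, hi⟩ : ∃ i, ¬ (-(m : ℤ) < k i ∧ k i < m) := by
    simpa [latticeCube, Fintype.mem_piFinset] using hk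
  rw [← abs_lt, not_lt] at hi
  calc (m : ℝ) ≤ |(k i : ℝ)| := by exact_mod_cast hi
    _ = ‖k i‖ := (Int.norm_eq_abs _).symm
    _ ≤ ‖k‖ := norm_le_pi_norm k i

theorem latticeNorm_zero (hr : 0 < r) : latticeNorm r (0 : Fin d → ℤ) = 0 := by
  unfold latticeNorm
  split_ifs with h
  · simp
  · have hr' := ENNReal.toReal_pos hr.ne' h
    simp [Real.zero_rpow, hr'.ne']

theorem norm_le_latticeNorm (hr : 0 < r) (k : Fin d → ℤ) : ‖k‖ ≤ latticeNorm r k := by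
  have hnonneg : 0 ≤ latticeNorm r k := by
    unfold latticeNorm
    split_ifs
    · exact Real.iSup_nonneg fun i => abs_nonneg _
    · positivity
  refine (pi_norm_le_iff_of_nonneg hnonneg).mpr fun i => ?_
  rw [Int.norm_eq_abs, latticeNorm]
  split_ifs with h
  · exact le_ciSup (f := fun i => |(k i : ℝ)|) (Finite.bddAbove_range _) i
  · have hr' := ENNReal.toReal_pos hr.ne' h
    rw [one_div, Real.le_rpow_inv_iff_of_pos (abs_nonneg _) (by positivity) hr']
    exact Finset.single_le_sum (f := fun i => |(k i : ℝ)| ^ r.toReal) (fun i _ => by positivity)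
      (Finset.mem_univ i)

-- For `r = ∞` the exponent `1 / r.toReal` is `1 / 0 = 0`, so the constant is `1`, as it should be.
theorem latticeNorm_le_mul_norm (hr : 0 < r) (k : Fin d → ℤ) :
    latticeNorm r k ≤ (d : ℝ) ^ (1 / r.toReal) * ‖k‖ := by
  have hcoord (i : Fin d) : |(k i : ℝ)| ≤ ‖k‖ :=
    (Int.norm_eq_abs _).symm.trans_le (norm_le_pi_norm k i)
  unfold latticeNorm
  split_ifs with h
  · simpa [h] using Real.iSup_le hcoord (norm_nonneg k)
  · have hr' := ENNReal.toReal_pos hr.ne' h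
    calc (∑ i, |(k i : ℝ)| ^ r.toReal) ^ (1 / r.toReal)
        ≤ (∑ _i : Fin d, ‖k‖ ^ r.toReal) ^ (1 / r.toReal) := by
          gcongr with i
          exact hcoord i
      _ = (d : ℝ) ^ (1 / r.toReal) * ‖k‖ := by
          rw [Finset.sum_const, Finset.card_univ, Fintype.card_fin, nsmul_eq_mul,
            Real.mul_rpow (by positivity) (by positivity), one_div,
            Real.rpow_rpow_inv (norm_nonneg k) hr'.ne']

theorem one_le_norm (hk : k ≠ 0) : 1 ≤ ‖k‖ := by
  obtain ⟨i, hi⟩ := Function.ne_iff.mp hk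
  calc (1 : ℝ) ≤ |(k i : ℝ)| := by exact_mod_cast Int.one_le_abs hi
    _ = ‖k i‖ := (Int.norm_eq_abs _).symm
    _ ≤ ‖k‖ := norm_le_pi_norm k i

theorem weight_eq (hr : 0 < r) (ψ : ℝ → ℝ) (k : Fin d → ℤ) :
    weight ψ r k = ψ (max 1 (latticeNorm r k)) := by
  unfold weight
  rcases eq_or_ne k 0 with rfl | hk
  · simp [latticeNorm_zero hr]
  · have h1 : 1 ≤ latticeNorm r k := (one_le_norm hk).trans (norm_le_latticeNorm hr k)
    rw [if_neg (by positivity), max_eq_right h1]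

theorem weight_pos (hr : 0 < r) (hpos : ∀ t, 1 ≤ t → 0 < ψ t) (k : Fin d → ℤ) :
    0 < weight ψ r k := by
  rw [weight_eq hr]
  exact hpos _ (le_max_left _ _)

theorem weight_le (hr : 0 < r) (hanti : AntitoneOn ψ (Ici 1)) (k : Fin d → ℤ) :
    weight ψ r k ≤ ψ (max 1 ‖k‖) := by
  rw [weight_eq hr]
  exact hanti (mem_Ici.mpr (le_max_left _ _)) (mem_Ici.mpr (le_max_left _ _))
    (max_le_max_left 1 (norm_le_latticeNorm hr k))

theorem le_weight (hr : 0 < r) (hanti : AntitoneOn ψ (Ici 1)) (ht : 1 ≤ t)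
    (hk : latticeNorm r k ≤ t) : ψ t ≤ weight ψ r k := by
  rw [weight_eq hr]
  exact hanti (mem_Ici.mpr (le_max_left _ _)) ht (max_le ht hk)

theorem weight_le_of_notMem_latticeCube (hr : 0 < r) (hanti : AntitoneOn ψ (Ici 1))
    (hk : k ∉ latticeCube d m) : weight ψ r k ≤ ψ (max 1 m) :=
  (weight_le hr hanti k).trans <| hanti (mem_Ici.mpr (le_max_left _ _))
    (mem_Ici.mpr (le_max_left _ _)) (max_le_max_left 1 (le_norm_of_notMem_latticeCube hk))

theorem enorm_indicator_compl_latticeCube_weight_le (hr : 0 < r) (hpos : ∀ t, 1 ≤ t → 0 < ψ t)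
    (hanti : AntitoneOn ψ (Ici 1)) (k : Fin d → ℤ) :
    ‖(latticeCube d m : Set (Fin d → ℤ))ᶜ.indicator (weight ψ r) k‖ₑ
      ≤ ‖{k : Fin d → ℤ | max 1 (m : ℝ) ≤ max 1 ‖k‖}.indicator (fun k => ψ (max 1 ‖k‖)) k‖ₑ := by
  by_cases hk : k ∈ latticeCube d m
  · simp [hk]
  · have hmem : k ∈ {k : Fin d → ℤ | max 1 (m : ℝ) ≤ max 1 ‖k‖} :=
      max_le_max_left 1 (le_norm_of_notMem_latticeCube hk)
    rw [Set.indicator_of_mem (by simpa using hk), Set.indicator_of_mem hmem,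
      Real.enorm_of_nonneg (weight_pos hr hpos k).le,
      Real.enorm_of_nonneg (hpos _ (le_max_left _ _)).le]
    exact ENNReal.ofReal_le_ofReal (weight_le hr hanti k)

theorem card_latticeCube_ceil_le (d : ℕ) (ht : 1 ≤ t) :
    ((latticeCube d ⌈t⌉₊).card : ℝ) ≤ (3 * t) ^ d := by
  have hceil := Nat.ceil_lt_add_one (zero_le_one.trans ht)
  have hpos : 1 ≤ 2 * ⌈t⌉₊ := by
    have := Nat.ceil_pos.mpr (zero_lt_one.trans_le ht)
    omega
  rw [card_latticeCube, Nat.cast_pow, Nat.cast_sub hpos]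
  push_cast
  have : (1 : ℝ) ≤ 2 * ⌈t⌉₊ := by exact_mod_cast hpos
  gcongr
  linarith

end LatticeCubes

section DoublingAndDecay

variable {ψ : ℝ → ℝ} {a b p t₀ K : ℝ}

/-- The doubling property of a function on `[1, ∞)`: its values at `t` and at `c * t` are comparable
for some `c > 1`. Only one inequality is required, the other one holds for antitone functions. -/
def IsDoubling (ψ : ℝ → ℝ) : Prop :=
  ∃ c C : ℝ, 1 < c ∧ ∀ t, 1 ≤ t → ψ t ≤ C * ψ (c * t)

/-- The function `ψ` decays on `[1, ∞)` at least as fast as `t ^ (-K)`, uniformly in the starting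
point: `t ^ K * ψ t` is almost decreasing. -/
def HasPowerDecay (ψ : ℝ → ℝ) (K : ℝ) : Prop :=
  ∃ C : ℝ, 0 < C ∧ ∀ u t, 1 ≤ u → u ≤ t → ψ t ≤ C * ψ u * (u / t) ^ K

theorem MemB.isDoubling (hp : 0 < p) (hpos : ∀ t, 1 ≤ t → 0 < ψ t)
    (hB : MemB fun t => ψ t ^ p) : IsDoubling ψ := by
  obtain ⟨c, K, hc, hK⟩ := hB.doubling
  refine ⟨c, K ^ p⁻¹, hc, fun t ht => ?_⟩
  have hct : 0 < ψ (c * t) := hpos _ (by nlinarith)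
  obtain ⟨hlt, hle⟩ := hK t ht
  have hpow : ψ t ^ p ≤ K * ψ (c * t) ^ p := (div_le_iff₀ (Real.rpow_pos_of_pos hct p)).mp hle
  have hK0 : 0 ≤ K := by linarith
  rw [← Real.rpow_le_rpow_iff (hpos t ht).le (by positivity) hp, Real.mul_rpow (by positivity)
    hct.le, Real.rpow_inv_rpow hK0 hp.ne']
  exact hpow

theorem IsDoubling.exists_le_mul (hψ : IsDoubling ψ) (hpos : ∀ t, 1 ≤ t → 0 < ψ t)
    (hanti : AntitoneOn ψ (Ici 1)) (l : ℝ) :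
    ∃ C : ℝ, 0 < C ∧ ∀ t, 1 ≤ t → ∀ u, 1 ≤ u → u ≤ l * t → ψ t ≤ C * ψ u := by
  obtain ⟨c, C, hc, hC⟩ := hψ
  have hC0 : 0 < C := by
    have h1 : 0 < C * ψ (c * 1) := (hpos 1 le_rfl).trans_le (hC 1 le_rfl)
    exact pos_of_mul_pos_left h1 (hpos _ (by linarith)).le
  have hiter (j : ℕ) (t : ℝ) (ht : 1 ≤ t) : ψ t ≤ C ^ j * ψ (c ^ j * t) := by
    induction j with
    | zero => simp
    | succ j ih =>
      calc ψ t ≤ C ^ j * ψ (c ^ j * t) := ih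
        _ ≤ C ^ j * (C * ψ (c * (c ^ j * t))) := by
            gcongr
            exact hC _ (one_le_mul_of_one_le_of_one_le (one_le_pow₀ hc.le) ht)
        _ = C ^ (j + 1) * ψ (c ^ (j + 1) * t) := by ring_nf
  obtain ⟨j, hj⟩ := pow_unbounded_of_one_lt l hc
  refine ⟨C ^ j, by positivity, fun t ht u hu hut => (hiter j t ht).trans ?_⟩
  have huj : u ≤ c ^ j * t := hut.trans (by gcongr)
  gcongr
  exact hanti hu (hu.trans huj) huj

theorem div_le_deriv_neg_log_of_le_inv_alpha {t : ℝ} (ht : 0 < t) (hψ : 0 < ψ t)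
    (hderiv : deriv ψ t ≤ 0) (hdiff : DifferentiableAt ℝ ψ t) (hα : K ≤ 1 / alpha ψ t) :
    K * t⁻¹ ≤ deriv (fun u => -Real.log (ψ u)) t := by
  rw [alpha, one_div_div, hdiff.derivWithin (uniqueDiffWithinAt_Ioi t), abs_of_nonpos hderiv] at hα
  rw [deriv.fun_neg, deriv.log hdiff hψ.ne']
  calc K * t⁻¹ ≤ t * -deriv ψ t / ψ t * t⁻¹ := by gcongr
    _ = -(deriv ψ t / ψ t) := by field_simp

-- `-log ∘ ψ` is monotone, so the integral of its derivative is at most its increment, even if it is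
-- not absolutely continuous.
theorem mul_log_div_le_of_le_inv_alpha (ha : 0 < a) (hab : a ≤ b)
    (hpos : ∀ t ∈ Icc a b, 0 < ψ t) (hanti : AntitoneOn ψ (Icc a b))
    (hα : ∀ t ∈ Ioo a b, K ≤ 1 / alpha ψ t) :
    K * Real.log (b / a) ≤ Real.log (ψ a) - Real.log (ψ b) := by
  have hmono : MonotoneOn (fun t => -Real.log (ψ t)) (uIcc a b) := by
    rw [uIcc_of_le hab]
    exact fun s hs t ht hst => neg_le_neg (Real.log_le_log (hpos t ht) (hanti hs ht hst))
  have hderiv : ∀ᵐ t ∂volume.restrict (Ioo a b),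
      K * t⁻¹ ≤ deriv (fun u => -Real.log (ψ u)) t := by
    rw [ae_restrict_iff' measurableSet_Ioo]
    filter_upwards [hanti.neg.ae_differentiableWithinAt_of_mem] with t hdiff ht
    have hnhds : Icc a b ∈ 𝓝 t := Icc_mem_nhds ht.1 ht.2
    have htI := Ioo_subset_Icc_self ht
    refine div_le_deriv_neg_log_of_le_inv_alpha (ha.trans ht.1) (hpos t htI) ?_ ?_ (hα t ht)
    · rw [← derivWithin_of_mem_nhds hnhds]
      exact hanti.derivWithin_nonpos
    · simpa using ((hdiff htI).differentiableAt hnhds).neg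
  have hint : IntervalIntegrable (fun t => K * t⁻¹) volume a b :=
    (intervalIntegrable_inv_iff.mpr
      (Or.inr (notMem_uIcc_of_lt ha (ha.trans_le hab)))).const_mul K
  calc K * Real.log (b / a) = ∫ t in a..b, K * t⁻¹ := by
        rw [intervalIntegral.integral_const_mul, integral_inv_of_pos ha (ha.trans_le hab)]
    _ ≤ ∫ t in a..b, deriv (fun u => -Real.log (ψ u)) t :=
        intervalIntegral.integral_mono_ae_restrict hab hint hmono.intervalIntegrable_deriv
          (by rwa [restrict_Ioo_eq_restrict_Icc] at hderiv)
    _ ≤ -Real.log (ψ b) - -Real.log (ψ a) := by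
        have hmem := hmono.intervalIntegral_deriv_mem_uIcc
        rw [uIcc_of_le (sub_nonneg.mpr (hmono left_mem_uIcc right_mem_uIcc hab))] at hmem
        exact hmem.2
    _ = Real.log (ψ a) - Real.log (ψ b) := by ring

theorem mul_rpow_le_mul_rpow_of_le_inv_alpha (ha : 0 < a) (hab : a ≤ b)
    (hpos : ∀ t ∈ Icc a b, 0 < ψ t) (hanti : AntitoneOn ψ (Icc a b))
    (hα : ∀ t ∈ Ioo a b, K ≤ 1 / alpha ψ t) : ψ b * b ^ K ≤ ψ a * a ^ K := by
  have hb : 0 < b := ha.trans_le hab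
  have hψa := hpos a (left_mem_Icc.mpr hab)
  have hψb := hpos b (right_mem_Icc.mpr hab)
  have hlog := mul_log_div_le_of_le_inv_alpha ha hab hpos hanti hα
  rw [Real.log_div hb.ne' ha.ne'] at hlog
  rw [← Real.log_le_log_iff (by positivity) (by positivity),
    Real.log_mul hψb.ne' (by positivity), Real.log_mul hψa.ne' (by positivity),
    Real.log_rpow hb, Real.log_rpow ha]
  linarith

theorem hasPowerDecay_of_le_inv_alpha (hK : 0 ≤ K) (hpos : ∀ t, 1 ≤ t → 0 < ψ t)
    (hanti : AntitoneOn ψ (Ici 1)) (hα : ∀ t, t₀ < t → K ≤ 1 / alpha ψ t) :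
    HasPowerDecay ψ K := by
  set t₁ := max 1 t₀
  have ht₁ : 1 ≤ t₁ := le_max_left 1 t₀
  have decay {a b : ℝ} (ha : t₁ ≤ a) (hab : a ≤ b) : ψ b * b ^ K ≤ ψ a * a ^ K := by
    have hIcc : Icc a b ⊆ Ici 1 := fun t ht => ht₁.trans (ha.trans ht.1)
    exact mul_rpow_le_mul_rpow_of_le_inv_alpha (by linarith) hab (fun t ht => hpos t (hIcc ht))
      (hanti.mono hIcc) fun t ht => hα t ((le_max_right 1 t₀).trans_lt (ha.trans_lt ht.1))
  refine ⟨t₁ ^ K, by positivity, fun u t hu hut => ?_⟩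
  -- Compare `t` and `u` with an intermediate point `a ≤ t₁ * u`: `a = t` if both lie below the
  -- threshold `t₁`, otherwise the larger one of `u` and `t₁`.
  obtain ⟨a, hau, hψa, hta⟩ : ∃ a, u ≤ a ∧ a ≤ t₁ * u ∧ ψ t * t ^ K ≤ ψ a * a ^ K := by
    rcases le_total t t₁ with htt₁ | htt₁
    · exact ⟨t, hut, by nlinarith, le_rfl⟩
    · exact ⟨max u t₁, le_max_left _ _, max_le (by nlinarith) (by nlinarith),
        decay (le_max_right _ _) (max_le hut htt₁)⟩
  have ht0 : 0 < t := by linarith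
  have hψu := hpos u hu
  rw [Real.div_rpow (by positivity) ht0.le, ← mul_div_assoc, le_div_iff₀ (by positivity)]
  calc ψ t * t ^ K ≤ ψ a * a ^ K := hta
    _ ≤ ψ u * (t₁ * u) ^ K := by
        have ha0 : 0 < a := by linarith
        gcongr
        exact hanti hu (hu.trans hau) hau
    _ = t₁ ^ K * ψ u * u ^ K := by
        rw [Real.mul_rpow (by positivity) (by positivity)]
        ring

end DoublingAndDecay

section TailSums

variable {d : ℕ} {ψ : ℝ → ℝ} {K s ρ : ℝ}

theorem exists_mem_latticeCube_dyadic {k : Fin d → ℤ} (hρ : 0 < ρ) (hk : ρ ≤ max 1 ‖k‖) :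
    ∃ j : ℕ, 2 ^ j * ρ ≤ max 1 ‖k‖ ∧ k ∈ latticeCube d ⌈2 ^ (j + 1) * ρ⌉₊ := by
  obtain ⟨j, hle, hlt⟩ := exists_nat_pow_near ((one_le_div hρ).mpr hk) one_lt_two
  rw [le_div_iff₀ hρ] at hle
  rw [div_lt_iff₀ hρ] at hlt
  refine ⟨j, hle, ?_⟩
  by_contra hmem
  exact hlt.not_ge <| (Nat.le_ceil _).trans <|
    (le_norm_of_notMem_latticeCube hmem).trans (le_max_right _ _)

theorem tsum_indicator_le_tsum_dyadic {F : ℝ → ℝ≥0∞} (hF : AntitoneOn F (Ici 1)) (hρ : 1 ≤ ρ) :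
    ∑' k : Fin d → ℤ, {k | ρ ≤ max 1 ‖k‖}.indicator (fun k => F (max 1 ‖k‖)) k
      ≤ ∑' j : ℕ, ENNReal.ofReal ((3 * (2 ^ (j + 1) * ρ)) ^ d) * F (2 ^ j * ρ) := by
  have hdyadic (j : ℕ) : 1 ≤ 2 ^ j * ρ :=
    one_le_mul_of_one_le_of_one_le (one_le_pow₀ one_le_two) hρ
  set cube : ℕ → Finset (Fin d → ℤ) := fun j => latticeCube d ⌈2 ^ (j + 1) * ρ⌉₊
  have hshell (k : Fin d → ℤ) : {k | ρ ≤ max 1 ‖k‖}.indicator (fun k => F (max 1 ‖k‖)) k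
      ≤ ∑' j, (cube j : Set (Fin d → ℤ)).indicator (fun _ => F (2 ^ j * ρ)) k := by
    refine Set.indicator_apply_le' (fun hk => ?_) fun _ => zero_le
    obtain ⟨j, hle, hmem⟩ := exists_mem_latticeCube_dyadic (zero_lt_one.trans_le hρ) hk
    calc F (max 1 ‖k‖) ≤ F (2 ^ j * ρ) := hF (hdyadic j) ((hdyadic j).trans hle) hle
      _ = (cube j : Set (Fin d → ℤ)).indicator (fun _ => F (2 ^ j * ρ)) k := by
          rw [Set.indicator_of_mem (Finset.mem_coe.mpr hmem)]
      _ ≤ _ := ENNReal.le_tsum j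
  calc _ ≤ ∑' k, ∑' j, (cube j : Set (Fin d → ℤ)).indicator (fun _ => F (2 ^ j * ρ)) k :=
        ENNReal.tsum_le_tsum hshell
    _ = ∑' j, (cube j).card * F (2 ^ j * ρ) := by
        rw [ENNReal.tsum_comm]
        refine tsum_congr fun j => ?_
        rw [← sum_eq_tsum_indicator, Finset.sum_const, nsmul_eq_mul]
    _ ≤ _ := by
        gcongr with j
        rw [← ENNReal.ofReal_natCast]
        exact ENNReal.ofReal_le_ofReal (card_latticeCube_ceil_le d (hdyadic (j + 1)))

theorem two_pow_mul_two_inv_rpow_lt_one (hKs : d < K * s) :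
    (2 : ℝ) ^ d * ((2⁻¹ : ℝ) ^ K) ^ s < 1 := by
  calc (2 : ℝ) ^ d * ((2⁻¹ : ℝ) ^ K) ^ s = 2 ^ (d - K * s) := by
        rw [Real.inv_rpow two_pos.le, ← Real.rpow_neg two_pos.le, ← Real.rpow_mul two_pos.le,
          ← Real.rpow_natCast, ← Real.rpow_add two_pos, neg_mul, sub_eq_add_neg]
    _ < 1 := Real.rpow_lt_one_of_one_lt_of_neg one_lt_two (by linarith)

theorem HasPowerDecay.exists_tsum_dyadic_le (hψ : HasPowerDecay ψ K)
    (hpos : ∀ t, 1 ≤ t → 0 < ψ t) (hs : 0 < s) (hKs : d < K * s) :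
    ∃ T : ℝ, 0 < T ∧ ∀ ρ, 1 ≤ ρ →
      ∑' j : ℕ, ENNReal.ofReal ((3 * (2 ^ (j + 1) * ρ)) ^ d) * ENNReal.ofReal (ψ (2 ^ j * ρ) ^ s)
        ≤ ENNReal.ofReal (T * (ρ ^ d * ψ ρ ^ s)) := by
  obtain ⟨C, hC, hdecay⟩ := hψ
  set θ : ℝ := 2 ^ d * ((2⁻¹ : ℝ) ^ K) ^ s with hθ
  have hθ0 : 0 < θ := by positivity
  have hθ1 : θ < 1 := two_pow_mul_two_inv_rpow_lt_one hKs
  refine ⟨6 ^ d * C ^ s * (1 - θ)⁻¹,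
    mul_pos (by positivity) (inv_pos.mpr (sub_pos.mpr hθ1)), fun ρ hρ => ?_⟩
  have hρ0 : 0 < ρ := zero_lt_one.trans_le hρ
  have hψρ := hpos ρ hρ
  have hterm (j : ℕ) : (3 * (2 ^ (j + 1) * ρ)) ^ d * ψ (2 ^ j * ρ) ^ s
      ≤ 6 ^ d * C ^ s * (ρ ^ d * ψ ρ ^ s) * θ ^ j := by
    have hρj : ρ ≤ 2 ^ j * ρ := le_mul_of_one_le_left hρ0.le (one_le_pow₀ one_le_two)
    have hψj := hpos _ (hρ.trans hρj)
    have hθj : θ ^ j = (2 ^ j) ^ d * (((2 ^ j)⁻¹ : ℝ) ^ K) ^ s := by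
      rw [hθ, mul_pow, pow_right_comm, Real.rpow_pow_comm (by positivity),
        Real.rpow_pow_comm (by positivity), inv_pow]
    calc (3 * (2 ^ (j + 1) * ρ)) ^ d * ψ (2 ^ j * ρ) ^ s
        ≤ (3 * (2 ^ (j + 1) * ρ)) ^ d * (C * ψ ρ * (ρ / (2 ^ j * ρ)) ^ K) ^ s := by
          gcongr
          exact hdecay ρ _ hρ hρj
      _ = 6 ^ d * C ^ s * (ρ ^ d * ψ ρ ^ s) * θ ^ j := by
          rw [hθj, div_mul_cancel_right₀ hρ0.ne', Real.mul_rpow (by positivity) (by positivity),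
            Real.mul_rpow hC.le hψρ.le, pow_succ, show (6 : ℝ) = 3 * 2 by norm_num]
          ring
  calc _ = ∑' j : ℕ, ENNReal.ofReal ((3 * (2 ^ (j + 1) * ρ)) ^ d * ψ (2 ^ j * ρ) ^ s) :=
        tsum_congr fun j => (ENNReal.ofReal_mul (by positivity)).symm
    _ ≤ ∑' j : ℕ, ENNReal.ofReal (6 ^ d * C ^ s * (ρ ^ d * ψ ρ ^ s) * θ ^ j) :=
        ENNReal.tsum_le_tsum fun j => ENNReal.ofReal_le_ofReal (hterm j)
    _ = ENNReal.ofReal (∑' j : ℕ, 6 ^ d * C ^ s * (ρ ^ d * ψ ρ ^ s) * θ ^ j) :=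
        (ENNReal.ofReal_tsum_of_nonneg (fun j => by positivity)
          ((summable_geometric_of_lt_one hθ0.le hθ1).mul_left _)).symm
    _ = ENNReal.ofReal (6 ^ d * C ^ s * (1 - θ)⁻¹ * (ρ ^ d * ψ ρ ^ s)) := by
        rw [tsum_mul_left, tsum_geometric_of_lt_one hθ0.le hθ1]
        ring_nf

theorem HasPowerDecay.exists_lsNorm_tail_le (hψ : HasPowerDecay ψ K)
    (hpos : ∀ t, 1 ≤ t → 0 < ψ t) (hanti : AntitoneOn ψ (Ici 1)) (hs : 0 < s) (hKs : d < K * s) :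
    ∃ T : ℝ, 0 < T ∧ ∀ ρ, 1 ≤ ρ →
      lsNorm s ({k : Fin d → ℤ | ρ ≤ max 1 ‖k‖}.indicator fun k => ψ (max 1 ‖k‖))
        ≤ ENNReal.ofReal (T * ((ρ ^ d) ^ (1 / s) * ψ ρ)) := by
  obtain ⟨T, hT, htail⟩ := hψ.exists_tsum_dyadic_le hpos hs hKs
  refine ⟨T ^ (1 / s), by positivity, fun ρ hρ => ?_⟩
  have hψρ := hpos ρ hρ
  have hanti_rpow : AntitoneOn (fun t => ENNReal.ofReal (ψ t ^ s)) (Ici 1) := fun t ht u hu htu =>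
    ENNReal.ofReal_le_ofReal (Real.rpow_le_rpow (hpos u hu).le (hanti ht hu htu) hs.le)
  have henorm (k : Fin d → ℤ) :
      ‖{k : Fin d → ℤ | ρ ≤ max 1 ‖k‖}.indicator (fun k => ψ (max 1 ‖k‖)) k‖ₑ ^ s
        = {k | ρ ≤ max 1 ‖k‖}.indicator (fun k => ENNReal.ofReal (ψ (max 1 ‖k‖) ^ s)) k := by
    have hψk := hpos _ (le_max_left 1 ‖k‖)
    by_cases hk : k ∈ {k : Fin d → ℤ | ρ ≤ max 1 ‖k‖}
    · rw [Set.indicator_of_mem hk, Set.indicator_of_mem hk, Real.enorm_of_nonneg hψk.le,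
        ENNReal.ofReal_rpow_of_pos hψk]
    · rw [Set.indicator_of_notMem hk, Set.indicator_of_notMem hk, enorm_zero,
        ENNReal.zero_rpow_of_pos hs]
  calc _ ≤ ENNReal.ofReal (T * (ρ ^ d * ψ ρ ^ s)) ^ (1 / s) := by
        rw [lsNorm, tsum_congr henorm]
        exact ENNReal.rpow_le_rpow
          ((tsum_indicator_le_tsum_dyadic hanti_rpow hρ).trans (htail ρ hρ)) (by positivity)
    _ = ENNReal.ofReal (T ^ (1 / s) * ((ρ ^ d) ^ (1 / s) * ψ ρ)) := by
        rw [ENNReal.ofReal_rpow_of_pos (by positivity), Real.mul_rpow hT.le (by positivity),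
          Real.mul_rpow (by positivity) (by positivity), one_div, Real.rpow_rpow_inv hψρ.le hs.ne']

end TailSums

section Estimates

variable {d n : ℕ} {r : ℝ≥0∞} {p q K y : ℝ} {ψ : ℝ → ℝ}

theorem exists_two_mul_card_latticeCube_le (hd : 1 ≤ d) (hy : 1 ≤ y) :
    ∃ m : ℕ, 2 * ((latticeCube d m).card : ℝ) ≤ y ^ d ∧ max 1 (m : ℝ) ≤ y ∧
      y ≤ 8 * max 1 (m : ℝ) := by
  have hfloor : (⌊y / 4⌋₊ : ℝ) ≤ y / 4 := Nat.floor_le (by linarith)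
  refine ⟨⌊y / 4⌋₊, ?_, max_le hy (by linarith), ?_⟩
  · have hside : ((2 * ⌊y / 4⌋₊ - 1 : ℕ) : ℝ) ≤ y / 2 := by
      calc ((2 * ⌊y / 4⌋₊ - 1 : ℕ) : ℝ) ≤ (2 * ⌊y / 4⌋₊ : ℕ) := by gcongr; omega
        _ ≤ y / 2 := by push_cast; linarith
    have htwo : (2 : ℝ) ≤ 2 ^ d := le_self_pow₀ one_le_two (by omega)
    calc 2 * ((latticeCube d ⌊y / 4⌋₊).card : ℝ) ≤ 2 ^ d * (y / 2) ^ d := by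
          rw [card_latticeCube, Nat.cast_pow]
          gcongr
      _ = y ^ d := by rw [← mul_pow, mul_div_cancel₀ _ two_ne_zero]
  · linarith [Nat.lt_floor_add_one (y / 4), le_max_left 1 (⌊y / 4⌋₊ : ℝ),
      le_max_right 1 (⌊y / 4⌋₊ : ℝ)]

theorem exists_two_mul_le_card_latticeCube (hd : 1 ≤ d) (hy : 1 ≤ y) :
    ∃ m : ℕ, 2 * y ^ d ≤ (latticeCube d m).card ∧ (m : ℝ) ≤ 3 * y := by
  refine ⟨⌈y⌉₊ + 1, ?_, ?_⟩
  · have hside : 2 * y ≤ ((2 * (⌈y⌉₊ + 1) - 1 : ℕ) : ℝ) := by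
      rw [show 2 * (⌈y⌉₊ + 1) - 1 = 2 * ⌈y⌉₊ + 1 by omega]
      push_cast
      linarith [Nat.le_ceil y]
    calc 2 * y ^ d ≤ 2 ^ d * y ^ d := by
          gcongr
          exact le_self_pow₀ one_le_two (by omega)
      _ = (2 * y) ^ d := (mul_pow _ _ _).symm
      _ ≤ (latticeCube d (⌈y⌉₊ + 1)).card := by
          rw [card_latticeCube, Nat.cast_pow]
          gcongr
  · push_cast
    linarith [Nat.ceil_lt_add_one (zero_le_one.trans hy)]

theorem rpow_one_div_natCast_pow (hd : 1 ≤ d) (n : ℕ) : ((n : ℝ) ^ (1 / (d : ℝ))) ^ d = n := by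
  rw [one_div, Real.rpow_inv_natCast_pow n.cast_nonneg (by omega)]

theorem exists_bestNTermClass_le_of_le (hd : 1 ≤ d) (hr : 0 < r) (hq : 0 < q) (hqp : q ≤ p)
    (hpos : ∀ t, 1 ≤ t → 0 < ψ t) (hanti : AntitoneOn ψ (Ici 1)) (hψ : IsDoubling ψ) :
    ∃ C : ℝ, ∀ n : ℕ, 1 ≤ n → bestNTermClass p n (classF d q r ψ) ≤
      ENNReal.ofReal (C * (ψ ((n : ℝ) ^ (1 / (d : ℝ))) / (n : ℝ) ^ (1 / q - 1 / p))) := by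
  have : Nonempty (Fin d) := Fin.pos_iff_nonempty.mp hd
  obtain ⟨C, hC, hCψ⟩ := hψ.exists_le_mul hpos hanti 8
  refine ⟨C * 2 ^ (1 / q - 1 / p), fun n hn => bestNTermClass_le (hq.trans_le hqp) fun a ha => ?_⟩
  have hy : 1 ≤ (n : ℝ) ^ (1 / (d : ℝ)) :=
    Real.one_le_rpow (by exact_mod_cast hn) (by positivity)
  obtain ⟨m, hcard, -, hym⟩ := exists_two_mul_card_latticeCube_le hd hy
  rw [rpow_one_div_natCast_pow hd n] at hcard
  set y := (n : ℝ) ^ (1 / (d : ℝ))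
  have hweight (k : Fin d → ℤ) (hk : k ∉ latticeCube d m) : weight ψ r k ≤ C * ψ y :=
    (weight_le_of_notMem_latticeCube hr hanti hk).trans (hCψ _ (le_max_left _ _) y hy hym)
  calc nTermError p n a ≤ ENNReal.ofReal (C * ψ y * (n / 2 : ℝ) ^ (1 / p - 1 / q)) :=
        nTermError_le_of_weight_le hq hqp (weight_pos hr hpos) ha hweight hn
          (by exact_mod_cast hcard)
    _ = ENNReal.ofReal (C * 2 ^ (1 / q - 1 / p) * (ψ y / (n : ℝ) ^ (1 / q - 1 / p))) := by
        rw [← neg_sub (1 / q), Real.rpow_neg (by positivity),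
          Real.div_rpow (by positivity) (by positivity)]
        congr 1
        field_simp

theorem exists_bestNTermClass_le_of_lt (hd : 1 ≤ d) (hr : 0 < r) (hp : 0 < p) (hpq : p < q)
    (hpos : ∀ t, 1 ≤ t → 0 < ψ t) (hanti : AntitoneOn ψ (Ici 1)) (hψ : IsDoubling ψ)
    (hK : d * (1 / p - 1 / q) < K) (hdecay : HasPowerDecay ψ K) :
    ∃ C : ℝ, ∀ n : ℕ, 1 ≤ n → bestNTermClass p n (classF d q r ψ) ≤
      ENNReal.ofReal (C * (ψ ((n : ℝ) ^ (1 / (d : ℝ))) / (n : ℝ) ^ (1 / q - 1 / p))) := by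
  have : Nonempty (Fin d) := Fin.pos_iff_nonempty.mp hd
  have hpq' : 0 < 1 / p - 1 / q := sub_pos.mpr (one_div_lt_one_div_of_lt hp hpq)
  set s : ℝ := (1 / p - 1 / q)⁻¹ with hs
  have hs' : 1 / s = 1 / p - 1 / q := by rw [hs, one_div, inv_inv]
  obtain ⟨C, -, hCψ⟩ := hψ.exists_le_mul hpos hanti 8
  obtain ⟨T, hT, htail⟩ := hdecay.exists_lsNorm_tail_le (d := d) hpos hanti (inv_pos.mpr hpq')
    ((lt_mul_inv_iff₀ hpq').mpr hK)
  refine ⟨T * C, fun n hn => bestNTermClass_le hp fun a ha => ?_⟩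
  have hy : 1 ≤ (n : ℝ) ^ (1 / (d : ℝ)) :=
    Real.one_le_rpow (by exact_mod_cast hn) (by positivity)
  obtain ⟨m, hcard, hmy, hym⟩ := exists_two_mul_card_latticeCube_le hd hy
  have hyd := rpow_one_div_natCast_pow hd n
  set y := (n : ℝ) ^ (1 / (d : ℝ))
  set ρ := max 1 (m : ℝ)
  have hψρ : ψ ρ ≤ C * ψ y := hCψ ρ (le_max_left _ _) y hy hym
  have hcard' : (latticeCube d m).card ≤ n := by
    have : 2 * (latticeCube d m).card ≤ n := by exact_mod_cast hcard.trans_eq hyd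
    omega
  calc nTermError p n a
      ≤ lsNorm s ((latticeCube d m : Set (Fin d → ℤ))ᶜ.indicator (weight ψ r)) :=
        nTermError_le_lsNorm_weight hp hpq (by rw [hs']; ring) (weight_pos hr hpos) ha hcard'
    _ ≤ lsNorm s ({k : Fin d → ℤ | ρ ≤ max 1 ‖k‖}.indicator fun k => ψ (max 1 ‖k‖)) :=
        lsNorm_mono (inv_pos.mpr hpq') (enorm_indicator_compl_latticeCube_weight_le hr hpos hanti)
    _ ≤ ENNReal.ofReal (T * ((ρ ^ d) ^ (1 / s) * ψ ρ)) := htail ρ (le_max_left _ _)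
    _ ≤ ENNReal.ofReal (T * ((y ^ d) ^ (1 / s) * (C * ψ y))) := by
        have hψρ0 := hpos ρ (le_max_left _ _)
        gcongr
    _ = ENNReal.ofReal (T * C * (ψ y / (n : ℝ) ^ (1 / q - 1 / p))) := by
        rw [hyd, hs', ← neg_sub (1 / q), Real.rpow_neg (by positivity)]
        ring_nf

theorem le_bestNTermClass_of_le_weight (hp : 0 < p) (hq : 0 < q) {Γ : Finset (Fin d → ℤ)}
    (hΓ0 : Γ.Nonempty) (hΓ : 2 * n ≤ Γ.card) {v : ℝ} (hv : 0 ≤ v)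
    (h : ∀ k ∈ Γ, v ≤ weight ψ r k) :
    ENNReal.ofReal ((n : ℝ) ^ (1 / p) * (v / (Γ.card : ℝ) ^ (1 / q)))
      ≤ bestNTermClass p n (classF d q r ψ) := by
  have hcard : (0 : ℝ) < Γ.card := by exact_mod_cast hΓ0.card_pos
  set δ : ℝ := v / (Γ.card : ℝ) ^ (1 / q)
  have hδ : 0 ≤ δ := by positivity
  set c : (Fin d → ℤ) → ℂ := fun _ => δ
  have hquot : (fun k => ‖(Γ : Set (Fin d → ℤ)).indicator c k‖ / weight ψ r k)
      = (Γ : Set (Fin d → ℤ)).indicator fun k => δ / weight ψ r k := by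
    ext k
    by_cases hk : k ∈ Γ <;> simp [hk, c, abs_of_nonneg hδ]
  have hle (k : Fin d → ℤ) (hk : k ∈ Γ) :
      ‖δ / weight ψ r k‖ₑ ≤ ENNReal.ofReal ((Γ.card : ℝ) ^ (1 / q))⁻¹ := by
    have hw : 0 ≤ weight ψ r k := hv.trans (h k hk)
    rw [Real.enorm_of_nonneg (by positivity)]
    refine ENNReal.ofReal_le_ofReal (div_le_of_le_mul₀ hw (by positivity) ?_)
    rw [inv_mul_eq_div]
    exact div_le_div_of_nonneg_right (h k hk) (by positivity)
  have hclass : lsNorm q (fun k => ‖(Γ : Set (Fin d → ℤ)).indicator c k‖ / weight ψ r k) ≤ 1 := by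
    rw [hquot]
    refine (lsNorm_indicator_le hq Γ hle).trans_eq ?_
    rw [← ENNReal.ofReal_natCast, ENNReal.ofReal_rpow_of_pos hcard,
      ← ENNReal.ofReal_mul (by positivity), mul_inv_cancel₀ (by positivity), ENNReal.ofReal_one]
  calc ENNReal.ofReal ((n : ℝ) ^ (1 / p) * δ) = (n : ℝ≥0∞) ^ (1 / p) * ENNReal.ofReal δ := by
        rw [ENNReal.ofReal_mul (by positivity),
          ← ENNReal.ofReal_rpow_of_nonneg n.cast_nonneg (by positivity), ENNReal.ofReal_natCast]
    _ ≤ nTermError p n ((Γ : Set (Fin d → ℤ)).indicator c) :=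
        rpow_mul_le_nTermError hp hΓ fun k hk => by
          rw [Set.indicator_of_mem (Finset.mem_coe.mpr hk), ← ofReal_norm, Complex.norm_real,
            Real.norm_of_nonneg hδ]
    _ ≤ bestNTermClass p n (classF d q r ψ) := nTermError_indicator_le_bestNTermClass hp n hclass

theorem exists_le_bestNTermClass (hd : 1 ≤ d) (hr : 0 < r) (hp : 0 < p) (hq : 0 < q)
    (hpos : ∀ t, 1 ≤ t → 0 < ψ t) (hanti : AntitoneOn ψ (Ici 1)) (hψ : IsDoubling ψ) :
    ∃ c : ℝ, 0 < c ∧ ∀ n : ℕ, 1 ≤ n →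
      ENNReal.ofReal (c * (ψ ((n : ℝ) ^ (1 / (d : ℝ))) / (n : ℝ) ^ (1 / q - 1 / p)))
        ≤ bestNTermClass p n (classF d q r ψ) := by
  set l : ℝ := (d : ℝ) ^ (1 / r.toReal) * 3
  have hl : 1 ≤ l := by
    have : 1 ≤ (d : ℝ) ^ (1 / r.toReal) := Real.one_le_rpow (by exact_mod_cast hd) (by positivity)
    linarith
  obtain ⟨C, hC, hCψ⟩ := hψ.exists_le_mul hpos hanti l
  refine ⟨(C * 2 ^ (1 / q))⁻¹, by positivity, fun n hn => ?_⟩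
  have hy : 1 ≤ (n : ℝ) ^ (1 / (d : ℝ)) :=
    Real.one_le_rpow (by exact_mod_cast hn) (by positivity)
  obtain ⟨m, hcard, hm⟩ := exists_two_mul_le_card_latticeCube hd hy
  rw [rpow_one_div_natCast_pow hd n] at hcard
  set y := (n : ℝ) ^ (1 / (d : ℝ))
  have hly : 1 ≤ l * y := one_le_mul_of_one_le_of_one_le hl hy
  obtain ⟨Γ, hΓm, hΓ⟩ := Finset.exists_subset_card_eq (s := latticeCube d m) (n := 2 * n)
    (by exact_mod_cast hcard)
  have hweight (k : Fin d → ℤ) (hk : k ∈ Γ) : ψ (l * y) ≤ weight ψ r k := by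
    refine le_weight hr hanti hly ?_
    calc latticeNorm r k ≤ (d : ℝ) ^ (1 / r.toReal) * ‖k‖ := latticeNorm_le_mul_norm hr k
      _ ≤ (d : ℝ) ^ (1 / r.toReal) * (3 * y) := by
          gcongr
          exact (norm_le_of_mem_latticeCube (hΓm hk)).trans hm
      _ = l * y := by ring
  have hn0 : (0 : ℝ) < n := by exact_mod_cast hn
  refine le_trans (ENNReal.ofReal_le_ofReal ?_) <| le_bestNTermClass_of_le_weight hp hq
    (Finset.card_pos.mp (by omega)) hΓ.ge (hpos _ hly).le hweight
  calc (C * 2 ^ (1 / q))⁻¹ * (ψ y / (n : ℝ) ^ (1 / q - 1 / p))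
      ≤ (C * 2 ^ (1 / q))⁻¹ * (C * ψ (l * y) / (n : ℝ) ^ (1 / q - 1 / p)) := by
        gcongr
        exact hCψ y hy _ hly le_rfl
    _ = (n : ℝ) ^ (1 / p) * (ψ (l * y) / (Γ.card : ℝ) ^ (1 / q)) := by
        rw [hΓ, Nat.cast_mul, Nat.cast_ofNat, Real.mul_rpow two_pos.le hn0.le,
          Real.rpow_sub hn0]
        field_simp

end Estimates

end NTerm

theorem mainTheorem4_general (d : ℕ) (hd : 1 ≤ d) (r : ℝ≥0∞) (hr : 0 < r) (p q : ℝ) (hp : 0 < p)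
    (hq : 0 < q) (ψ : ℝ → ℝ) (hψpos : ∀ t, 1 ≤ t → 0 < ψ t) (hψanti : AntitoneOn ψ (Ici 1))
    (hψ : NTerm.IsDoubling ψ)
    (hdecay : p < q → ∃ K : ℝ, d * (1 / p - 1 / q) < K ∧ NTerm.HasPowerDecay ψ K) :
    NTerm.SameOrder
      (fun n => NTerm.bestNTermClass p n (NTerm.classF d q r ψ))
      (fun n => ψ ((n : ℝ) ^ (1 / (d : ℝ))) / (n : ℝ) ^ (1 / q - 1 / p)) := by
  obtain ⟨c, hc, hlower⟩ := NTerm.exists_le_bestNTermClass hd hr hp hq hψpos hψanti hψ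
  obtain ⟨C, hupper⟩ : ∃ C : ℝ, ∀ n : ℕ, 1 ≤ n →
      NTerm.bestNTermClass p n (NTerm.classF d q r ψ) ≤
        ENNReal.ofReal (C * (ψ ((n : ℝ) ^ (1 / (d : ℝ))) / (n : ℝ) ^ (1 / q - 1 / p))) := by
    rcases le_or_gt q p with hqp | hpq
    · exact NTerm.exists_bestNTermClass_le_of_le hd hr hq hqp hψpos hψanti hψ
    · obtain ⟨K, hK, hψK⟩ := hdecay hpq
      exact NTerm.exists_bestNTermClass_le_of_lt hd hr hp hpq hψpos hψanti hψ hK hψK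
  refine ⟨c, max C (c + 1), hc, lt_max_of_lt_right (lt_add_one c), fun n hn =>
    ⟨hlower n hn, (hupper n hn).trans (ENNReal.ofReal_le_ofReal ?_)⟩⟩
  have hψn : 0 < ψ ((n : ℝ) ^ (1 / (d : ℝ))) :=
    hψpos _ (Real.one_le_rpow (by exact_mod_cast hn) (by positivity))
  gcongr
  exact le_max_left C (c + 1)

theorem mainTheorem4 (d : ℕ) (hd : 1 ≤ d) (r : ℝ≥0∞) (hr : 0 < r)
    (p q : ℝ) (hp : 1 ≤ p) (hq : 0 < q)
    (M₀ c₁ c₂ : ℝ) (hM₀ : 0 < M₀) (hc₁ : 0 < c₁) (hc₂ : 0 < c₂)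
    (hV : ∀ᶠ m : ℕ in atTop,
      M₀ * ((m : ℝ) - c₁) ^ d < (NTerm.latticeCount d r m : ℝ) ∧
        (NTerm.latticeCount d r m : ℝ) ≤ M₀ * ((m : ℝ) + c₂) ^ d)
    (ψ : ℝ → ℝ) (hψpos : ∀ t, 1 ≤ t → 0 < ψ t) (hψanti : AntitoneOn ψ (Ici 1))
    (hB : NTerm.MemB (fun t => ψ t ^ p))
    (hconv : p < q → ∃ t₀ Kψ : ℝ, (d : ℝ) * (1 / p - 1 / q) < Kψ ∧
      ConvexOn ℝ (Ioi t₀) (fun t => ψ t ^ p) ∧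
      ∀ t, t₀ < t → Kψ ≤ 1 / NTerm.alpha ψ t) :
    NTerm.SameOrder
      (fun n => NTerm.bestNTermClass p n (NTerm.classF d q r ψ))
      (fun n => ψ ((n : ℝ) ^ (1 / (d : ℝ))) / (n : ℝ) ^ (1 / q - 1 / p)) := by
  have hp0 : 0 < p := zero_lt_one.trans_le hp
  refine mainTheorem4_general d hd r hr p q hp0 hq ψ hψpos hψanti (hB.isDoubling hp0 hψpos) ?_
  intro hpq
  obtain ⟨t₀, K, hdK, -, hα⟩ := hconv hpq
  have hK : 0 ≤ K := hdK.le.trans' <|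
    mul_nonneg d.cast_nonneg (sub_nonneg.mpr (one_div_le_one_div_of_le hp0 hpq.le))
  exact ⟨K, hdK, NTerm.hasPowerDecay_of_le_inv_alpha hK hψpos hψanti hα⟩
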